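/- Let $0\le n<m$ and let $\mathcal A$ be the $\mathbb C$-algebra of formal power series in the non-commuting variables $a_{ij}$, $1\le i,j\le m$, i.e. of arbitrary infinite $\mathbb C$-linear combinations of words in the $a_{ij}$. The determinant of a $k\times k$ matrix $B=(b_{ij})$ over a non-commutative ring is $$\det B=\sum_{\sigma\in S_k}(-1)^{\operatorname{inv}\sigma}\,b_{\sigma(1)1}b_{\sigma(2)2}\cdots b_{\sigma(k)k},$$ and a square matrix $A=(a_{ij})$ is called right-quantum if $$a_{jk}a_{ik}=a_{ik}a_{jk}\quad\text{for all } k \text{ and all } i\ne j,$$ $$a_{ik}a_{jl}-a_{jk}a_{il}=a_{jl}a_{ik}-a_{il}a_{jk}\quad\text{for all } i\neq j,\ k\ne l.$$ Let $\mathcal I$ be a two-sided ideal of $\mathcal A$ such that the matrix $A=(a_{ij})_{m\times m}$, with entries read in $\mathcal A/\mathcal I$, is right-quantum (for example, the ideal generated by the relations above). Put $$A_0=(a_{ij})_{1\le i,j\le n},\qquad a_{i*}=(a_{i1},\dots,a_{in}),\qquad a_{*j}=(a_{1j},\dots,a_{nj})^{T}.$$ Then $\det(I-A_0)$ is invertible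 in $\mathcal A/\mathcal I$. Let $C=(c_{ij})_{n+1\le i,j\le m}$ be the matrix with entries $$c_{ij}=-\det{}^{-1}(I-A_0)\cdot\det\begin{pmatrix} I-A_0 & -a_{*j}\\ -a_{i*} & -a_{ij}\end{pmatrix}.$$ Then $C$ is again right-quantum, and in $\mathcal A/\mathcal I$ $$\det{}^{-1}(I-A_0)\cdot\det(I-A)=\det(I-C).$$ -/

import Mathlib

/-- Formal power series with coefficients in `K` in the non-commuting variables indexed by `σ`:
arbitrary (possibly infinite) linear combinations of words, given by the coefficient of each
word. -/
@[ext]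
structure NCPowerSeries (σ K : Type*) where
  coeff : List σ → K

namespace NCPowerSeries

variable {σ K : Type*} [Ring K]

instance : Zero (NCPowerSeries σ K) := ⟨⟨fun _ => 0⟩⟩
instance : One (NCPowerSeries σ K) := ⟨⟨fun w => match w with | [] => 1 | _ :: _ => 0⟩⟩
instance : Add (NCPowerSeries σ K) := ⟨fun f g => ⟨fun w => f.coeff w + g.coeff w⟩⟩
instance : Neg (NCPowerSeries σ K) := ⟨fun f => ⟨fun w => -f.coeff w⟩⟩

/-- The product extends concatenation of words: the coefficient of `w` in `f * g` is the sum of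
`f.coeff u * g.coeff v` over all factorizations `w = u ++ v`. -/
instance : Mul (NCPowerSeries σ K) :=
  ⟨fun f g => ⟨fun w => ∑ k ∈ Finset.range (w.length + 1),
    f.coeff (w.take k) * g.coeff (w.drop k)⟩⟩

@[simp] theorem coeff_zero (w : List σ) : (0 : NCPowerSeries σ K).coeff w = 0 := rfl
@[simp] theorem coeff_one_nil : (1 : NCPowerSeries σ K).coeff [] = 1 := rfl
@[simp] theorem coeff_one_cons (x : σ) (w : List σ) :
    (1 : NCPowerSeries σ K).coeff (x :: w) = 0 := rfl
@[simp] theorem coeff_add (f g : NCPowerSeries σ K) (w : List σ) :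
    (f + g).coeff w = f.coeff w + g.coeff w := rfl
@[simp] theorem coeff_neg (f : NCPowerSeries σ K) (w : List σ) :
    (-f).coeff w = -f.coeff w := rfl
theorem coeff_mul (f g : NCPowerSeries σ K) (w : List σ) :
    (f * g).coeff w = ∑ k ∈ Finset.range (w.length + 1),
      f.coeff (w.take k) * g.coeff (w.drop k) := rfl

theorem coeff_one_of_ne_nil {w : List σ} (h : w ≠ []) : (1 : NCPowerSeries σ K).coeff w = 0 := by
  cases w with
  | nil => exact absurd rfl h
  | cons x w => rfl

protected theorem mul_assoc' (f g h : NCPowerSeries σ K) : f * g * h = f * (g * h) := by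
  ext w
  simp only [coeff_mul, Finset.sum_mul, Finset.mul_sum]
  rw [Finset.sum_sigma', Finset.sum_sigma']
  refine Finset.sum_bij' (fun x _ => ⟨x.2, x.1 - x.2⟩) (fun x _ => ⟨x.1 + x.2, x.1⟩) ?_ ?_ ?_ ?_ ?_
  · rintro ⟨a, b⟩ hab
    simp only [Finset.mem_sigma, Finset.mem_range, List.length_take, List.length_drop] at hab ⊢
    omega
  · rintro ⟨a, b⟩ hab
    simp only [Finset.mem_sigma, Finset.mem_range, List.length_take, List.length_drop] at hab ⊢
    omega
  · rintro ⟨a, b⟩ hab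
    simp only [Finset.mem_sigma, Finset.mem_range, List.length_take] at hab
    simp only [Sigma.mk.injEq, heq_eq_eq, and_true]
    omega
  · rintro ⟨a, b⟩ hab
    simp
  · rintro ⟨a, b⟩ hab
    simp only [Finset.mem_sigma, Finset.mem_range, List.length_take] at hab
    have h1 : min b a = b := by omega
    have h2 : b + (a - b) = a := by omega
    simp only [List.take_take, List.drop_take, List.drop_drop, h1, h2, mul_assoc]

protected theorem one_mul' (f : NCPowerSeries σ K) : 1 * f = f := by
  ext w
  rw [coeff_mul, Finset.sum_eq_single 0]
  · simp
  · intro k hk hk0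
    rw [coeff_one_of_ne_nil, zero_mul]
    intro h
    have := congrArg List.length h
    simp only [Finset.mem_range, List.length_take, List.length_nil] at hk this
    omega
  · simp

protected theorem mul_one' (f : NCPowerSeries σ K) : f * 1 = f := by
  ext w
  rw [coeff_mul, Finset.sum_eq_single w.length]
  · simp
  · intro k hk hk0
    rw [coeff_one_of_ne_nil, mul_zero]
    intro h
    have := congrArg List.length h
    simp only [Finset.mem_range, List.length_drop, List.length_nil] at hk this
    omega
  · simp

instance : Ring (NCPowerSeries σ K) where
  add_assoc f g h := by ext w; simp [add_assoc]
  zero_add f := by ext w; simp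
  add_zero f := by ext w; simp
  add_comm f g := by ext w; simp [add_comm]
  nsmul := nsmulRec
  zsmul := zsmulRec
  neg_add_cancel f := by ext w; simp
  left_distrib f g h := by ext w; simp [coeff_mul, mul_add, Finset.sum_add_distrib]
  right_distrib f g h := by ext w; simp [coeff_mul, add_mul, Finset.sum_add_distrib]
  zero_mul f := by ext w; simp [coeff_mul]
  mul_zero f := by ext w; simp [coeff_mul]
  mul_assoc := NCPowerSeries.mul_assoc'
  one_mul := NCPowerSeries.one_mul'
  mul_one := NCPowerSeries.mul_one'

open Classical in
/-- The variable indexed by `s`: the one-letter word `s` with coefficient `1`. -/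
noncomputable def X (s : σ) : NCPowerSeries σ K := ⟨fun w => if w = [s] then 1 else 0⟩

end NCPowerSeries

/-- The determinant of a square matrix over a non-commutative ring,
`∑_σ (-1)^{inv σ} b_{σ(1) 1} b_{σ(2) 2} ⋯ b_{σ(n) n}`, the factors being multiplied in the order of
the columns. -/
def ncDet {R : Type*} [Ring R] {n : ℕ} (B : Matrix (Fin n) (Fin n) R) : R :=
  ∑ σ : Equiv.Perm (Fin n), Equiv.Perm.sign σ • (List.ofFn fun j => B (σ j) j).prod

/-- Right-quantum matrices. -/
structure IsRightQuantum {R : Type*} [Ring R] {m : ℕ} (A : Matrix (Fin m) (Fin m) R) : Prop where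
  column : ∀ i j k, i ≠ j → A j k * A i k = A i k * A j k
  cross : ∀ i j k l, i ≠ j → k ≠ l →
    A i k * A j l - A j k * A i l = A j l * A i k - A i l * A j k

/-- The matrix `(a_{ij})` of the non-commuting variables, with the variables read modulo a
two-sided ideal `I` of the algebra of formal power series in them over `ℂ`. -/
noncomputable def variableMatrix {m : ℕ}
    (I : TwoSidedIdeal (NCPowerSeries (Fin m × Fin m) ℂ)) :
    Matrix (Fin m) (Fin m) I.ringCon.Quotient :=
  Matrix.of fun i j => I.ringCon.mk' (NCPowerSeries.X (i, j))

section Sylvester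

variable {R : Type*} [Ring R] {n p : ℕ}

/-- The upper left `n × n` block `A₀` of a matrix of size `m = n + p`. -/
def leadingBlock (A : Matrix (Fin (n + p)) (Fin (n + p)) R) : Matrix (Fin n) (Fin n) R :=
  A.submatrix (Fin.castAdd p) (Fin.castAdd p)

/-- The `(n + 1) × (n + 1)` matrix with blocks `I - A₀`, `-a_{*j}`, `-a_{i*}`, `-a_{ij}`, where the
indices `i, j : Fin p` stand for the last `p` indices of `A`. -/
def borderedMatrix (A : Matrix (Fin (n + p)) (Fin (n + p)) R) (i j : Fin p) :
    Matrix (Fin (n + 1)) (Fin (n + 1)) R :=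
  (Matrix.fromBlocks
    (1 - leadingBlock A)
    (Matrix.of fun (k : Fin n) (_ : Fin 1) => -A (Fin.castAdd p k) (Fin.natAdd n j))
    (Matrix.of fun (_ : Fin 1) (k : Fin n) => -A (Fin.natAdd n i) (Fin.castAdd p k))
    (Matrix.of fun (_ : Fin 1) (_ : Fin 1) => -A (Fin.natAdd n i) (Fin.natAdd n j))).submatrix
      finSumFinEquiv.symm finSumFinEquiv.symm

/-- The `p × p` matrix `C` of the `c_{ij} = -det⁻¹(I - A₀) · det (borderedMatrix A i j)`. -/
noncomputable def sylvesterMatrix (A : Matrix (Fin (n + p)) (Fin (n + p)) R) :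
    Matrix (Fin p) (Fin p) R :=
  Matrix.of fun i j =>
    -Ring.inverse (ncDet (1 - leadingBlock A)) * ncDet (borderedMatrix A i j)

end Sylvester

/-!
The proof is algebraic and works in an arbitrary ring `R`; power series serve only to invert
`det (1 - A₀)` and `1 - A₀`.

Let the variables `ψ i` of a Grassmann algebra commute with `R`, and attach `φ j = ∑ i, m_{ij} ψ i` to
the `j`-th column of a matrix `M`. The product of the `φ j` in the order of the columns is `det M`
times the product of the `ψ i` (`topCoeff_prod_grassmannVec`), and the right-quantum relations for `M`
give `φ j φ k = -φ k φ j` and `φ j ^ 2 = 0` (`IsManin.grassmannVec_mul_swap`,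
`IsManin.grassmannVec_mul_self`).

Let `M` have blocks `M₁₁, M₁₂, M₂₁, M₂₂`, and let `M₁₁ X = M₁₂`. Subtracting from the last columns the
right linear combinations of the first columns with coefficients `X` does not change the product of the
columns (`IsManin.prod_grassmannVec_sub_eq`), and it makes `M` block lower triangular. Hence
`det M = det M₁₁ * det S` with the Schur complement `S = M₂₂ - M₂₁ X`
(`IsManin.ncDet_eq_mul_schurComplement`). Applied to submatrices of `M` with two extra rows and columns,
this expresses `2 × 2` minors of `S` through minors of `M`, which are alternating in the columns; so
`S` is right-quantum too (`IsManin.schurComplement`).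

The right-quantum relations are between commutators and hold for `1 - A` and for the bordered matrices
along with `A`. The formula for a bordered matrix shows that `1 - C` is the Schur complement of
`1 - A₀` in `1 - A` (`one_sub_sylvesterMatrix`), and the formula for `1 - A` is then the identity.
-/

open scoped TensorProduct

/-! ### The Grassmann algebra with coefficients in a non-commutative ring -/

/-- The Grassmann algebra on `N` generators with coefficients in the non-commutative ring `R`.
Tensoring over `ℤ` makes the coefficients commute with the generators. -/
abbrev GrassmannRing (R : Type*) [Ring R] (N : ℕ) :=
  R ⊗[ℤ] ExteriorAlgebra ℤ (Fin N → ℤ)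

section Grassmann
variable {R : Type*} [Ring R] {N : ℕ}

/-- The `i`-th generator `ψ i` of the Grassmann algebra. -/
noncomputable def grassmannGen (i : Fin N) : ExteriorAlgebra ℤ (Fin N → ℤ) :=
  ExteriorAlgebra.ι ℤ (Pi.single i 1)

/-- The element `∑ i, v i ψ i` of the Grassmann algebra attached to a vector `v`. It will be applied
to the columns of matrices. -/
noncomputable def grassmannVec (v : Fin N → R) : GrassmannRing R N :=
  ∑ i, v i ⊗ₜ[ℤ] grassmannGen i

theorem grassmannVec_sub (v w : Fin N → R) :
    grassmannVec (v - w) = grassmannVec v - grassmannVec w := by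
  simp [grassmannVec, TensorProduct.sub_tmul]

/-- Right linear combinations of vectors go to right linear combinations. -/
theorem grassmannVec_sum_mul {κ : Type*} (s : Finset κ) (v : κ → Fin N → R) (x : κ → R) :
    grassmannVec (fun i => ∑ k ∈ s, v k i * x k) =
      ∑ k ∈ s, grassmannVec (v k) * (x k ⊗ₜ[ℤ] 1) := by
  simp only [grassmannVec, TensorProduct.sum_tmul, Finset.sum_mul,
    Algebra.TensorProduct.tmul_mul_tmul, mul_one]
  exact Finset.sum_comm

theorem grassmannVec_mul (v w : Fin N → R) :
    grassmannVec v * grassmannVec w =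
      ∑ q : Fin N × Fin N, (v q.1 * w q.2) ⊗ₜ[ℤ] (grassmannGen q.1 * grassmannGen q.2) := by
  simp only [grassmannVec, Finset.sum_mul_sum, Algebra.TensorProduct.tmul_mul_tmul,
    Fintype.sum_prod_type]

/-- A symmetric family of coefficients pairs to zero with the products `ψ i ψ j`. The terms cancel in
pairs, those on the diagonal being zero, so `2` need not be invertible in `R`. -/
theorem sum_symm_tmul_grassmannGen (c : Fin N × Fin N → R) (hc : ∀ q, c q.swap = c q) :
    ∑ q : Fin N × Fin N, c q ⊗ₜ[ℤ] (grassmannGen q.1 * grassmannGen q.2) = 0 := by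
  refine Finset.sum_involution (fun q _ => q.swap) ?_ ?_ (by simp) (by simp)
  · intro q _
    rw [hc, ← TensorProduct.tmul_add, Prod.fst_swap, Prod.snd_swap, grassmannGen, grassmannGen,
      ExteriorAlgebra.ι_add_mul_swap, TensorProduct.tmul_zero]
  · rintro ⟨i, j⟩ _ h0 heq
    obtain rfl : j = i := congrArg Prod.fst heq
    exact h0 (by simp [grassmannGen])

/-- The coefficient of `ψ 0 ⋯ ψ (N - 1)`. It is read off by the determinant, as the alternating map
on `N` vectors which takes the value `1` at the standard basis. -/
noncomputable def topCoeff (R : Type*) [Ring R] (N : ℕ) : GrassmannRing R N →+ R :=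
  ((TensorProduct.rid ℤ R).toLinearMap ∘ₗ LinearMap.lTensor R
    (ExteriorAlgebra.liftAlternating (R := ℤ) (M := Fin N → ℤ) (N := ℤ)
      (Function.update 0 N Matrix.detRowAlternating))).toAddMonoidHom

theorem prod_ofFn_tmul {k : ℕ} {B : Type*} [Ring B] (a : Fin k → R) (b : Fin k → B) :
    (List.ofFn fun j => a j ⊗ₜ[ℤ] b j).prod = (List.ofFn a).prod ⊗ₜ[ℤ] (List.ofFn b).prod := by
  induction k with
  | zero => simp [Algebra.TensorProduct.one_def]
  | succ k ih => simp [List.ofFn_succ, ih]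

theorem prod_ofFn_sum {B : Type*} [Ring B] {k : ℕ} {ι : Type*} [Fintype ι] [DecidableEq ι]
    (g : Fin k → ι → B) :
    (List.ofFn fun j => ∑ i, g j i).prod =
      ∑ f : Fin k → ι, (List.ofFn fun j => g j (f j)).prod := by
  simpa using (MultilinearMap.mkPiAlgebraFin ℤ k B).map_sum g

/-- A word `ψ (f 0) ⋯ ψ (f (N - 1))` has top coefficient `sign f` if `f` is a permutation and `0`
otherwise; both cases are covered by a sum over permutations. -/
theorem topCoeff_prod_gen (a : R) (f : Fin N → Fin N) :
    topCoeff R N (a ⊗ₜ[ℤ] (List.ofFn fun j => grassmannGen (f j)).prod) =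
      ∑ σ : Equiv.Perm (Fin N), if f = σ then Equiv.Perm.sign σ • a else 0 := by
  have h : (List.ofFn fun j => grassmannGen (f j)).prod =
      ExteriorAlgebra.ιMulti ℤ N (fun j => (Pi.single (f j) 1 : Fin N → ℤ)) := by
    rw [ExteriorAlgebra.ιMulti_apply]; rfl
  rw [h]
  change TensorProduct.rid ℤ R (a ⊗ₜ[ℤ] ExteriorAlgebra.liftAlternating _ _) = _
  rw [ExteriorAlgebra.liftAlternating_apply_ιMulti, Function.update_self, TensorProduct.rid_tmul]
  change Matrix.det (Matrix.of fun j => (Pi.single (f j) 1 : Fin N → ℤ)) • a = _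
  rw [← Matrix.det_transpose, Matrix.det_apply, Finset.sum_smul]
  refine Finset.sum_congr rfl fun σ _ => ?_
  simp only [Matrix.transpose_apply, Matrix.of_apply, Pi.single_apply]
  rw [Finset.prod_ite_zero]
  by_cases hf : f = σ
  · subst hf; simp [Units.smul_def]
  · have : ¬ ∀ i ∈ Finset.univ, σ i = f i := fun h' => hf (funext fun i => (h' i (by simp)).symm)
    rw [if_neg this, if_neg hf]; simp

/-- The determinant in column order is the top coefficient of the product of the columns. -/
theorem topCoeff_prod_grassmannVec (B : Matrix (Fin N) (Fin N) R) :
    topCoeff R N (List.ofFn fun j => grassmannVec fun i => B i j).prod = ncDet B := by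
  simp only [grassmannVec]
  rw [prod_ofFn_sum, map_sum]
  simp only [prod_ofFn_tmul, topCoeff_prod_gen]
  rw [Finset.sum_comm, ncDet]
  refine Finset.sum_congr rfl fun σ _ => ?_
  rw [Finset.sum_ite_eq' Finset.univ (σ : Fin N → Fin N)]
  simp

theorem prod_mul_eq_zero_of_mem {G : Type*} [Ring G] {l : List G} {x : G} (hx : x ∈ l)
    (hsq : x * x = 0) (hanti : ∀ y ∈ l, y * x = -(x * y)) : l.prod * x = 0 := by
  induction l using List.reverseRecOn with
  | nil => simp at hx
  | append_singleton l y ih =>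
    rw [List.prod_append, List.prod_singleton, mul_assoc]
    rcases List.mem_append.1 hx with h | h
    · rw [hanti y (by simp), mul_neg, ← mul_assoc,
        ih h fun z hz => hanti z (by simp [hz]), zero_mul, neg_zero]
    · rw [← List.mem_singleton.1 h, hsq, mul_zero]

end Grassmann

/-! ### Determinants over non-commutative rings -/

section Determinant
variable {R : Type*} [Ring R]

/-- The determinant of a block lower triangular matrix. No commutation is needed: in the last `p`
columns only the last `p` rows contribute. -/
theorem ncDet_eq_of_upperRight_zero {n p : ℕ} (B : Matrix (Fin (n + p)) (Fin (n + p)) R)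
    (hB : ∀ i j, B (Fin.castAdd p i) (Fin.natAdd n j) = 0) :
    ncDet B = ncDet (B.submatrix (Fin.castAdd p) (Fin.castAdd p)) *
      ncDet (B.submatrix (Fin.natAdd n) (Fin.natAdd n)) := by
  classical
  let e := (finSumFinEquiv (m := n) (n := p)).permCongr
  let b (σ : Equiv.Perm (Fin n ⊕ Fin p)) : R := Equiv.Perm.sign σ •
    ((List.ofFn fun j => B (finSumFinEquiv (σ (.inl j))) (Fin.castAdd p j)).prod *
      (List.ofFn fun j => B (finSumFinEquiv (σ (.inr j))) (Fin.natAdd n j)).prod)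
  have h1 : ncDet B = ∑ σ, b σ := by
    rw [ncDet, ← e.sum_comp]
    refine Finset.sum_congr rfl fun σ _ => ?_
    rw [Equiv.Perm.sign_permCongr, List.ofFn_add, List.prod_append]
    simp only [b]
    congr 3
    · congr 1
      funext j
      change B (finSumFinEquiv (σ (finSumFinEquiv.symm (Fin.castAdd p j)))) _ = _
      rw [finSumFinEquiv_symm_apply_castAdd]; rfl
    · congr 1
      funext j
      change B (finSumFinEquiv (σ (finSumFinEquiv.symm (Fin.natAdd n j)))) _ = _
      rw [finSumFinEquiv_symm_apply_natAdd]
  rw [h1, ncDet, ncDet, Finset.sum_mul_sum, ← Fintype.sum_prod_type']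
  symm
  refine Finset.sum_of_injOn (fun q => Equiv.Perm.sumCongrHom _ _ q)
    (Equiv.Perm.sumCongrHom_injective.injOn) (by simp) ?_ ?_
  · intro σ _ hσ
    -- The zero block constrains the preimages of the first `n` rows, hence the passage to `σ⁻¹`.
    have hmaps : ¬ Set.MapsTo (σ⁻¹ : Equiv.Perm _) (Set.range Sum.inl) (Set.range Sum.inl) := by
      intro hm
      obtain ⟨q, hq⟩ := inv_mem_iff.1 (Equiv.Perm.mem_sumCongrHom_range_of_perm_mapsTo_inl hm)
      exact hσ ⟨q, by simp, hq⟩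
    simp only [Set.MapsTo, not_forall] at hmaps
    obtain ⟨_, ⟨i, rfl⟩, hi⟩ := hmaps
    rcases hx : σ⁻¹ (Sum.inl i) with a | j
    · exact absurd ⟨a, hx.symm⟩ hi
    · have hj : σ (Sum.inr j) = Sum.inl i := by rw [← hx]; simp
      simp only [b]
      rw [List.prod_eq_zero (l := List.ofFn fun j =>
        B (finSumFinEquiv (σ (.inr j))) (Fin.natAdd n j)), mul_zero, smul_zero]
      rw [List.mem_ofFn]
      exact ⟨j, by rw [hj]; exact hB i j⟩
  · rintro ⟨σ, τ⟩ _
    simp only [b, Equiv.Perm.sumCongrHom_apply, Equiv.Perm.sign_sumCongr]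
    simp [mul_smul, smul_mul_assoc, mul_smul_comm, Matrix.submatrix, -zsmul_eq_mul,
      smul_comm (Equiv.Perm.sign τ)]

theorem ncDet_one_by_one (B : Matrix (Fin 1) (Fin 1) R) : ncDet B = B 0 0 := by
  simp [ncDet]

theorem ncDet_two_by_two (B : Matrix (Fin 2) (Fin 2) R) :
    ncDet B = B 0 0 * B 1 1 - B 1 0 * B 0 1 := by
  rw [ncDet, Finset.univ_perm_fin_succ]
  simp [Fin.sum_univ_succ, sub_eq_add_neg, ← Finset.univ_product_univ]

theorem map_ncDet {S : Type*} [Ring S] (f : R →+* S) {n : ℕ} (B : Matrix (Fin n) (Fin n) R) :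
    f (ncDet B) = ncDet (B.map f) := by
  simp only [ncDet, map_sum, Units.smul_def, map_zsmul, map_list_prod, List.map_ofFn]
  rfl

theorem ncDet_eq_det {S : Type*} [CommRing S] {n : ℕ} (B : Matrix (Fin n) (Fin n) S) :
    ncDet B = B.det := by
  simp only [ncDet, Matrix.det_apply, List.prod_ofFn]

end Determinant

/-! ### Manin matrices -/

section Manin
variable {R : Type*} [Ring R]

/-- The right-quantum relations for rectangular matrices, also known as Manin matrices. The relations
are required for all indices, so that they pass to submatrices with repeated rows or columns. -/
structure IsManin {ι κ : Type*} (M : Matrix ι κ R) : Prop where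
  column : ∀ i j k, M i k * M j k = M j k * M i k
  cross : ∀ i j k l, M i k * M j l - M j k * M i l = M j l * M i k - M i l * M j k

theorem IsRightQuantum.isManin {m : ℕ} {A : Matrix (Fin m) (Fin m) R} (hA : IsRightQuantum A) :
    IsManin A where
  column i j k := by
    rcases eq_or_ne i j with rfl | h
    · rfl
    · exact (hA.column i j k h).symm
  cross i j k l := by
    rcases eq_or_ne i j with rfl | h
    · simp
    rcases eq_or_ne k l with rfl | h'
    · rw [hA.column i j k h]
    · exact hA.cross i j k l h h'

theorem IsManin.isRightQuantum {m : ℕ} {A : Matrix (Fin m) (Fin m) R} (hA : IsManin A) :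
    IsRightQuantum A where
  column i j k _ := hA.column j i k
  cross i j k l _ _ := hA.cross i j k l

/-- The relations are between commutators, so they do not see integer constants. -/
theorem IsManin.of_intCast_sub {ι κ ι' κ' : Type*} {A : Matrix ι κ R} (hA : IsManin A)
    (r : ι' → ι) (c : κ' → κ) {M : Matrix ι' κ' R}
    (hM : ∀ i j, ∃ z : ℤ, M i j = z - A (r i) (c j)) : IsManin M := by
  choose z hz using hM
  have key (a b : ℤ) (x y : R) :
      (a - x) * (b - y) = (a * b : ℤ) - a * y - b * x + x * y := by
    rw [sub_mul, mul_sub, mul_sub, (Int.cast_commute b x).eq]; push_cast; abel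
  refine ⟨fun i j k => ?_, fun i j k l => ?_⟩
  · simp only [hz, key]
    rw [hA.column, mul_comm (z i k)]; abel
  · simp only [hz, key]
    have h := hA.cross (r i) (r j) (c k) (c l)
    rw [mul_comm (z j l), mul_comm (z i l)]
    rw [← sub_eq_zero] at h ⊢
    rw [← h]
    abel

theorem IsManin.submatrix {ι κ ι' κ' : Type*} {A : Matrix ι κ R} (hA : IsManin A)
    (r : ι' → ι) (c : κ' → κ) : IsManin (A.submatrix r c) :=
  ⟨fun _ _ _ => hA.column _ _ _, fun _ _ _ _ => hA.cross _ _ _ _⟩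

section
variable {κ : Type*} {N : ℕ} {M : Matrix (Fin N) κ R}

theorem IsManin.grassmannVec_mul_self (hM : IsManin M) (k : κ) :
    grassmannVec (fun i => M i k) * grassmannVec (fun i => M i k) = 0 := by
  rw [grassmannVec_mul]
  exact sum_symm_tmul_grassmannGen (fun q => M q.1 k * M q.2 k) fun q => hM.column _ _ _

theorem IsManin.grassmannVec_mul_swap (hM : IsManin M) (k l : κ) :
    grassmannVec (fun i => M i k) * grassmannVec (fun i => M i l) =
      -(grassmannVec (fun i => M i l) * grassmannVec (fun i => M i k)) := by
  rw [eq_neg_iff_add_eq_zero, grassmannVec_mul, grassmannVec_mul, ← Finset.sum_add_distrib]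
  simp only [← TensorProduct.add_tmul]
  refine sum_symm_tmul_grassmannGen (fun q => M q.1 k * M q.2 l + M q.1 l * M q.2 k) fun q => ?_
  have h := hM.cross q.1 q.2 k l
  simp only [Prod.fst_swap, Prod.snd_swap]
  rw [sub_eq_sub_iff_add_eq_add] at h
  rw [add_comm, ← sub_eq_zero]
  rw [← sub_eq_zero] at h
  rw [← neg_eq_zero, ← h]
  abel

end

/-- Subtracting from the last `p` columns right linear combinations of the first `n` columns of a Manin
matrix does not change the product of the columns. The coefficients `X k j` need not commute with
anything: the columns are replaced from left to right, so that each extra term is a product of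
unmodified columns, the `k`-th among them, times the `k`-th column again, and this vanishes before
the coefficient comes into play. -/
theorem IsManin.prod_grassmannVec_sub_eq {n p N : ℕ} {M : Matrix (Fin N) (Fin (n + p)) R}
    (hM : IsManin M) (X : Matrix (Fin n) (Fin p) R) :
    ((List.ofFn fun j : Fin n => grassmannVec fun i => M i (Fin.castAdd p j)) ++
      List.ofFn fun j : Fin p => grassmannVec fun i =>
        M i (Fin.natAdd n j) - ∑ k, M i (Fin.castAdd p k) * X k j).prod =
      (List.ofFn fun j => grassmannVec fun i => M i j).prod := by
  induction p with
  | zero => simp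
  | succ p ih =>
    have ih' := ih (M := M.submatrix id Fin.castSucc) (hM.submatrix _ _)
      (X.submatrix id Fin.castSucc)
    simp only [Matrix.submatrix_apply, id, List.prod_append] at ih'
    rw [List.prod_append, List.ofFn_succ_last (n := p), List.prod_append, List.prod_singleton,
      ← mul_assoc]
    erw [ih']
    rw [List.ofFn_succ_last (n := n + p), List.prod_append, List.prod_singleton]
    have hsplit : (grassmannVec fun i => M i (Fin.natAdd n (Fin.last p)) -
        ∑ k, M i (Fin.castAdd (p + 1) k) * X k (Fin.last p)) =
        grassmannVec (fun i => M i (Fin.natAdd n (Fin.last p))) -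
          ∑ k, grassmannVec (fun i => M i (Fin.castAdd (p + 1) k)) *
            (X k (Fin.last p) ⊗ₜ[ℤ] 1) := by
      rw [← grassmannVec_sum_mul, ← grassmannVec_sub]; rfl
    rw [hsplit, mul_sub, Finset.mul_sum, Finset.sum_eq_zero, sub_zero]
    · rfl
    · intro k _
      rw [← mul_assoc, prod_mul_eq_zero_of_mem, zero_mul]
      · exact List.mem_ofFn.2 ⟨Fin.castAdd p k, rfl⟩
      · exact hM.grassmannVec_mul_self _
      · intro y hy
        obtain ⟨j, rfl⟩ := List.mem_ofFn.1 hy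
        exact hM.grassmannVec_mul_swap _ _

/-- The Schur complement `M₂₂ - M₂₁ X`. Here `X` stands for `M₁₁⁻¹ M₁₂`; the lemmas below only
require `M₁₁ X = M₁₂`. -/
def schurComplement {n p q : ℕ} (M : Matrix (Fin (n + p)) (Fin (n + q)) R)
    (X : Matrix (Fin n) (Fin q) R) : Matrix (Fin p) (Fin q) R :=
  Matrix.of fun i j =>
    M (Fin.natAdd n i) (Fin.natAdd n j) - ∑ k, M (Fin.natAdd n i) (Fin.castAdd q k) * X k j

/-- Right multiplication of `M` by the block matrix with rows `(1, -X)` and `(0, 1)` keeps the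
determinant and gives a block lower triangular matrix with the Schur complement in the corner. -/
theorem IsManin.ncDet_eq_mul_schurComplement {n p : ℕ}
    {M : Matrix (Fin (n + p)) (Fin (n + p)) R} (hM : IsManin M) {X : Matrix (Fin n) (Fin p) R}
    (hX : ∀ i j, ∑ k, M (Fin.castAdd p i) (Fin.castAdd p k) * X k j =
      M (Fin.castAdd p i) (Fin.natAdd n j)) :
    ncDet M = ncDet (leadingBlock M) * ncDet (schurComplement M X) := by
  -- `B` has the columns of `M` after the column operations.
  let B : Matrix (Fin (n + p)) (Fin (n + p)) R := Matrix.of fun i =>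
    Fin.addCases (fun j => M i (Fin.castAdd p j))
      (fun j => M i (Fin.natAdd n j) - ∑ k, M i (Fin.castAdd p k) * X k j)
  have hBl (i j) : B i (Fin.castAdd p j) = M i (Fin.castAdd p j) := by simp [B]
  have hBr (i j) : B i (Fin.natAdd n j) =
      M i (Fin.natAdd n j) - ∑ k, M i (Fin.castAdd p k) * X k j := by simp [B]
  have h : ncDet M = ncDet B := by
    rw [← topCoeff_prod_grassmannVec, ← topCoeff_prod_grassmannVec,
      ← hM.prod_grassmannVec_sub_eq X, List.ofFn_add (f := fun j => grassmannVec fun i => B i j)]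
    simp only [hBr]
    simp only [← hBl]
    rfl
  rw [h, ncDet_eq_of_upperRight_zero B fun i j => by rw [hBr, hX, sub_self]]
  congr 2
  · ext i j; exact hBl _ _
  · ext i j; exact hBr _ _

theorem ncDet_submatrix_append_pair {n : ℕ} {κ : Type*} (M : Matrix (Fin (n + 2)) κ R)
    (c : Fin n → κ) (k l : κ) :
    ncDet (M.submatrix id (Fin.append c ![k, l])) = topCoeff R (n + 2)
      ((List.ofFn fun j => grassmannVec fun i => M i (c j)).prod *
        (grassmannVec (fun i => M i k) * grassmannVec (fun i => M i l))) := by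
  rw [← topCoeff_prod_grassmannVec, List.ofFn_add (m := 2), List.prod_append]
  simp only [Matrix.submatrix_apply, id, Fin.append_right, List.ofFn_succ (n := 1),
    List.ofFn_succ (n := 0), List.ofFn_zero, List.prod_cons, List.prod_nil, mul_one,
    Matrix.cons_val_zero, Matrix.cons_val_succ]
  congr 3
  refine congrArg List.ofFn (funext fun j => ?_)
  exact congrArg (fun t => grassmannVec fun i => M i t) (Fin.append_left c _ j)

theorem IsManin.ncDet_submatrix_append_swap {n : ℕ} {κ : Type*} {M : Matrix (Fin (n + 2)) κ R}
    (hM : IsManin M) (c : Fin n → κ) (k l : κ) :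
    ncDet (M.submatrix id (Fin.append c ![k, l])) =
      -ncDet (M.submatrix id (Fin.append c ![l, k])) := by
  rw [eq_neg_iff_add_eq_zero, ncDet_submatrix_append_pair, ncDet_submatrix_append_pair, ← map_add,
    ← mul_add, eq_neg_iff_add_eq_zero.1 (hM.grassmannVec_mul_swap k l), mul_zero, map_zero]

theorem IsManin.ncDet_submatrix_append_self {n : ℕ} {κ : Type*} {M : Matrix (Fin (n + 2)) κ R}
    (hM : IsManin M) (c : Fin n → κ) (k : κ) :
    ncDet (M.submatrix id (Fin.append c ![k, k])) = 0 := by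
  rw [ncDet_submatrix_append_pair, hM.grassmannVec_mul_self k, mul_zero, map_zero]

/-- The Schur complement `S` of a Manin matrix is Manin. By the determinant formula, `det M₁₁` times a
`2 × 2` minor of `S` is an `(n + 2) × (n + 2)` minor of `M`, which changes sign when its last two
columns are swapped and vanishes when they coincide. Cancelling `det M₁₁` gives the relations. -/
theorem IsManin.schurComplement {n p : ℕ}
    {M : Matrix (Fin (n + p)) (Fin (n + p)) R} (hM : IsManin M) {X : Matrix (Fin n) (Fin p) R}
    (hX : ∀ i j, ∑ k, M (Fin.castAdd p i) (Fin.castAdd p k) * X k j =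
      M (Fin.castAdd p i) (Fin.natAdd n j)) (hdet : IsUnit (ncDet (leadingBlock M))) :
    IsManin (schurComplement M X) := by
  let S := _root_.schurComplement M X
  let r (i j : Fin p) : Fin (n + 2) → Fin (n + p) :=
    Fin.append (Fin.castAdd p) ![Fin.natAdd n i, Fin.natAdd n j]
  have key (i j k l : Fin p) : ncDet (M.submatrix (r i j) (r k l)) =
      ncDet (leadingBlock M) * (S i k * S j l - S j k * S i l) := by
    have hr (a b : Fin p) (t : Fin 2) :
        r a b (Fin.natAdd n t) = Fin.natAdd n (![a, b] t) := by
      simp only [r, Fin.append_right]; fin_cases t <;> rfl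
    have hl (a b : Fin p) (t : Fin n) : r a b (Fin.castAdd 2 t) = Fin.castAdd p t := by
      simp only [r, Fin.append_left]
    rw [(hM.submatrix (r i j) (r k l)).ncDet_eq_mul_schurComplement
      (X := X.submatrix id ![k, l]) (fun s t => by
        simp only [Matrix.submatrix_apply, id, hr, hl]; exact hX _ _), ncDet_two_by_two]
    congr 2
    · ext s t; simp only [leadingBlock, Matrix.submatrix_apply, hl]
    all_goals simp [S, _root_.schurComplement, hr, hl]
  have hcol (i j k : Fin p) : S i k * S j k - S j k * S i k = 0 := by
    rw [← hdet.mul_right_eq_zero, ← key]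
    exact (hM.submatrix (r i j) id).ncDet_submatrix_append_self _ _
  have hcross (i j k l : Fin p) :
      S i k * S j l - S j k * S i l = -(S i l * S j k - S j l * S i k) := by
    rw [← hdet.mul_right_inj, mul_neg, ← key, ← key]
    exact (hM.submatrix (r i j) id).ncDet_submatrix_append_swap _ _ _
  exact ⟨fun i j k => sub_eq_zero.1 (hcol i j k), fun i j k l => by rw [hcross, neg_sub]⟩

end Manin

/-! ### Inverting power series and matrices of power series -/

namespace NCPowerSeries
variable {σ K : Type*} [Ring K]

/-- The coefficient of the empty word, as a ring homomorphism. -/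
def constantCoeff : NCPowerSeries σ K →+* K where
  toFun f := f.coeff []
  map_one' := rfl
  map_zero' := rfl
  map_add' _ _ := rfl
  map_mul' f g := by simp [coeff_mul]

/-- The coefficient of the word `w`, as an additive map. -/
def coeffHom (w : List σ) : NCPowerSeries σ K →+ K where
  toFun f := f.coeff w
  map_zero' := rfl
  map_add' _ _ := rfl

theorem constantCoeff_X (s : σ) : constantCoeff (X s : NCPowerSeries σ K) = 0 := by
  simp [constantCoeff, X]

variable {ι : Type*} [Fintype ι]

theorem coeff_matrix_mul (A B : Matrix ι ι (NCPowerSeries σ K)) (i j : ι) (w : List σ) :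
    ((A * B) i j).coeff w =
      ∑ k, ∑ s ∈ Finset.range (w.length + 1),
        (A i k).coeff (w.take s) * (B k j).coeff (w.drop s) := by
  rw [Matrix.mul_apply]
  change coeffHom w _ = _
  rw [map_sum]
  rfl

variable [DecidableEq ι]

theorem coeff_matrix_pow_eq_zero {A : Matrix ι ι (NCPowerSeries σ K)}
    (hA : ∀ i j, constantCoeff (A i j) = 0) (t : ℕ) (i j : ι) (w : List σ) (hw : w.length < t) :
    ((A ^ t) i j).coeff w = 0 := by
  induction t generalizing i w with
  | zero => simp at hw
  | succ t ih =>
    rw [pow_succ', coeff_matrix_mul]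
    refine Finset.sum_eq_zero fun k _ => Finset.sum_eq_zero fun s hs => ?_
    rcases s.eq_zero_or_pos with rfl | h0
    · rw [List.take_zero, show (A i k).coeff [] = 0 from hA i k, zero_mul]
    · rw [ih, mul_zero]
      rw [Finset.mem_range] at hs
      rw [List.length_drop]
      omega

/-- The geometric series `∑ A ^ t` is a right inverse of `1 - A` if the entries of `A` have no constant
term. -/
theorem exists_one_sub_mul_eq_one {A : Matrix ι ι (NCPowerSeries σ K)}
    (hA : ∀ i j, constantCoeff (A i j) = 0) :
    ∃ B : Matrix ι ι (NCPowerSeries σ K), (1 - A) * B = 1 := by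
  -- The coefficient of `w` in the sum of all powers is already that in `P (w.length + 1)`.
  let P (L : ℕ) : Matrix ι ι (NCPowerSeries σ K) := ∑ t ∈ Finset.range L, A ^ t
  have hP (L : ℕ) (i j : ι) (w : List σ) (hw : w.length < L) :
      (P L i j).coeff w = (P (w.length + 1) i j).coeff w := by
    induction L, hw using Nat.le_induction with
    | base => rfl
    | succ L hL ih =>
      rw [← ih]
      simp only [P, Finset.sum_range_succ, Matrix.add_apply, coeff_add,
        coeff_matrix_pow_eq_zero hA L i j w hL, add_zero]
  refine ⟨Matrix.of fun i j => ⟨fun w => (P (w.length + 1) i j).coeff w⟩, ?_⟩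
  ext i j w
  have h : ((1 - A) * P (w.length + 1)) i j = (1 - A ^ (w.length + 1)) i j := by
    rw [mul_neg_geom_sum]
  trans (((1 - A) * P (w.length + 1)) i j).coeff w
  · rw [coeff_matrix_mul, coeff_matrix_mul]
    refine Finset.sum_congr rfl fun k _ => Finset.sum_congr rfl fun s _ => ?_
    congr 1
    refine (hP _ _ _ _ ?_).symm
    rw [List.length_drop]
    omega
  · rw [h, sub_eq_add_neg, Matrix.add_apply, Matrix.neg_apply, coeff_add, coeff_neg,
      coeff_matrix_pow_eq_zero hA _ i j w (Nat.lt_succ_self _), neg_zero, add_zero]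

theorem isUnit_one_sub {A : Matrix ι ι (NCPowerSeries σ K)}
    (hA : ∀ i j, constantCoeff (A i j) = 0) : IsUnit (1 - A) := by
  obtain ⟨B, hB⟩ := exists_one_sub_mul_eq_one hA
  -- The right inverse is `B = 1 + A * B`, of the same shape, so it has a right inverse as well.
  have hAB (i j : ι) : constantCoeff ((-(A * B)) i j) = 0 := by
    simp [Matrix.neg_apply, Matrix.mul_apply, hA]
  obtain ⟨C, hC⟩ := exists_one_sub_mul_eq_one hAB
  have hB' : 1 + A * B = B :=
    (eq_add_of_sub_eq (by rwa [sub_mul, one_mul] at hB)).symm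
  have hBC : B * C = 1 := by rwa [sub_neg_eq_add, hB'] at hC
  have hCA : C = 1 - A := (left_inv_eq_right_inv hB hBC).symm
  exact ⟨⟨1 - A, B, hB, hCA ▸ hBC⟩, rfl⟩

theorem isUnit_of_constantCoeff_eq_one {f : NCPowerSeries σ K} (hf : constantCoeff f = 1) :
    IsUnit f := by
  have h := isUnit_one_sub (A := (Matrix.of fun (_ _ : Unit) => 1 - f)) (by simp [hf])
  have h' := h.map (Matrix.uniqueRingEquiv (m := Unit) (A := NCPowerSeries σ K))
  simpa using h'

end NCPowerSeries


/-! ### Sylvester's identity -/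

section Identity
variable {R : Type*} [Ring R] {n p : ℕ}

theorem leadingBlock_one_sub (A : Matrix (Fin (n + p)) (Fin (n + p)) R) :
    leadingBlock (1 - A) = 1 - leadingBlock A := by
  ext i j
  simp [leadingBlock, Matrix.one_apply]

theorem sum_mul_sum_of_mul_eq_one {B Y : Matrix (Fin n) (Fin n) R} (hY : B * Y = 1)
    (b : Fin n → R) (i : Fin n) : ∑ k, B i k * ∑ l, Y k l * b l = b i := by
  have h : B.mulVec (Y.mulVec b) = b := by rw [Matrix.mulVec_mulVec, hY, Matrix.one_mulVec]
  exact congrFun h i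

/-- The case of a `1 × 1` Schur complement; it says
`c_{ij} = a_{ij} + a_{i*} (1 - A₀)⁻¹ a_{*j}`. -/
theorem ncDet_borderedMatrix {A : Matrix (Fin (n + p)) (Fin (n + p)) R} (hA : IsManin A)
    {Y : Matrix (Fin n) (Fin n) R} (hY : (1 - leadingBlock A) * Y = 1) (i j : Fin p) :
    ncDet (borderedMatrix A i j) = -(ncDet (1 - leadingBlock A) *
      (A (Fin.natAdd n i) (Fin.natAdd n j) + ∑ k, A (Fin.natAdd n i) (Fin.castAdd p k) *
        ∑ l, Y k l * A (Fin.castAdd p l) (Fin.natAdd n j))) := by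
  let r (i : Fin p) : Fin (n + 1) → Fin (n + p) :=
    Fin.append (Fin.castAdd p) fun _ => Fin.natAdd n i
  have h11 (k l : Fin n) : borderedMatrix A i j (Fin.castAdd 1 k) (Fin.castAdd 1 l) =
      (1 - leadingBlock A) k l := by simp [borderedMatrix]
  have h12 (k : Fin n) (l : Fin 1) : borderedMatrix A i j (Fin.castAdd 1 k) (Fin.natAdd n l) =
      -A (Fin.castAdd p k) (Fin.natAdd n j) := by simp [borderedMatrix]
  have h21 (k : Fin 1) (l : Fin n) : borderedMatrix A i j (Fin.natAdd n k) (Fin.castAdd 1 l) =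
      -A (Fin.natAdd n i) (Fin.castAdd p l) := by simp [borderedMatrix]
  have h22 (k l : Fin 1) : borderedMatrix A i j (Fin.natAdd n k) (Fin.natAdd n l) =
      -A (Fin.natAdd n i) (Fin.natAdd n j) := by simp [borderedMatrix]
  have hM : IsManin (borderedMatrix A i j) := by
    refine hA.of_intCast_sub (r i) (r j) fun s t => ?_
    refine Fin.addCases (fun s => ?_) (fun s => ?_) s <;>
      refine Fin.addCases (fun t => ?_) (fun t => ?_) t
    · refine ⟨(1 : Matrix (Fin n) (Fin n) ℤ) s t, ?_⟩
      simp [h11, r, leadingBlock, Matrix.one_apply]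
    all_goals exact ⟨0, by simp [h12, h21, h22, r]⟩
  rw [hM.ncDet_eq_mul_schurComplement
    (X := Matrix.of fun k _ => -∑ l, Y k l * A (Fin.castAdd p l) (Fin.natAdd n j)),
    ncDet_one_by_one, ← mul_neg]
  · congr 2
    · ext k l; exact h11 k l
    · simp only [schurComplement, Matrix.of_apply, h22, h21, neg_mul_neg, neg_add, sub_eq_add_neg]
  · intro k t
    simp only [h11, h12, Matrix.of_apply, mul_neg, Finset.sum_neg_distrib]
    congr 1
    exact sum_mul_sum_of_mul_eq_one hY _ k

/-- `1 - C` is the Schur complement of `1 - A₀` in `1 - A`. -/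
theorem one_sub_sylvesterMatrix {A : Matrix (Fin (n + p)) (Fin (n + p)) R} (hA : IsManin A)
    (hdet : IsUnit (ncDet (1 - leadingBlock A)))
    {Y : Matrix (Fin n) (Fin n) R} (hY : (1 - leadingBlock A) * Y = 1) :
    1 - sylvesterMatrix A = schurComplement (1 - A)
      (Matrix.of fun k j => -∑ l, Y k l * A (Fin.castAdd p l) (Fin.natAdd n j)) := by
  ext i j
  simp only [Matrix.sub_apply, sylvesterMatrix, schurComplement, Matrix.of_apply,
    ncDet_borderedMatrix hA hY, neg_mul_neg, Ring.inverse_mul_cancel_left _ _ hdet]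
  have h1 : (1 : Matrix (Fin (n + p)) (Fin (n + p)) R) (Fin.natAdd n i) (Fin.natAdd n j) =
      (1 : Matrix (Fin p) (Fin p) R) i j := by simp [Matrix.one_apply]
  have h0 (k : Fin n) : (1 : Matrix (Fin (n + p)) (Fin (n + p)) R) (Fin.natAdd n i)
      (Fin.castAdd p k) = 0 := by
    refine Matrix.one_apply_ne fun h => ?_
    have := congrArg Fin.val h
    simp at this; omega
  simp only [h1, h0, zero_sub, neg_mul_neg, sub_sub]

/-- Sylvester's identity for a right-quantum matrix over any ring, as soon as `det (1 - A₀)` is a unit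
and `1 - A₀` has a right inverse. -/
theorem sylvester_identity {A : Matrix (Fin (n + p)) (Fin (n + p)) R} (hA : IsRightQuantum A)
    (hdet : IsUnit (ncDet (1 - leadingBlock A)))
    {Y : Matrix (Fin n) (Fin n) R} (hY : (1 - leadingBlock A) * Y = 1) :
    IsRightQuantum (sylvesterMatrix A) ∧
      Ring.inverse (ncDet (1 - leadingBlock A)) * ncDet (1 - A) =
        ncDet (1 - sylvesterMatrix A) := by
  have hM : IsManin (1 - A) := hA.isManin.of_intCast_sub id id fun i j =>
    ⟨(1 : Matrix _ _ ℤ) i j, by simp [Matrix.one_apply]⟩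
  have hX (i : Fin n) (j : Fin p) : ∑ k, (1 - A) (Fin.castAdd p i) (Fin.castAdd p k) *
      Matrix.of (fun k j => -∑ l, Y k l * A (Fin.castAdd p l) (Fin.natAdd n j)) k j =
        (1 - A) (Fin.castAdd p i) (Fin.natAdd n j) := by
    have h1 : (1 : Matrix (Fin (n + p)) (Fin (n + p)) R) (Fin.castAdd p i) (Fin.natAdd n j) =
        0 := by
      refine Matrix.one_apply_ne fun h => ?_
      have := congrArg Fin.val h
      simp at this; omega
    simp only [Matrix.of_apply, mul_neg, Finset.sum_neg_distrib]
    rw [Matrix.sub_apply _ _ _ (Fin.natAdd n j), h1, zero_sub]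
    congr 1
    rw [← leadingBlock_one_sub] at hY
    exact sum_mul_sum_of_mul_eq_one hY _ i
  have hC := one_sub_sylvesterMatrix hA.isManin hdet hY
  rw [← leadingBlock_one_sub] at hdet
  refine ⟨IsManin.isRightQuantum ?_, ?_⟩
  · refine (hM.schurComplement hX hdet).of_intCast_sub id id fun i j =>
      ⟨(1 : Matrix _ _ ℤ) i j, ?_⟩
    rw [← hC]
    simp [Matrix.one_apply]
  · rw [hC, hM.ncDet_eq_mul_schurComplement hX, ← leadingBlock_one_sub,
      Ring.inverse_mul_cancel_left _ _ hdet]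

end Identity

theorem theorem6p3 (n p : ℕ)
    (I : TwoSidedIdeal (NCPowerSeries (Fin (n + p) × Fin (n + p)) ℂ))
    (hA : IsRightQuantum (variableMatrix I)) :
    IsUnit (ncDet (1 - leadingBlock (variableMatrix I))) ∧
    IsRightQuantum (sylvesterMatrix (variableMatrix I)) ∧
    Ring.inverse (ncDet (1 - leadingBlock (variableMatrix I))) * ncDet (1 - variableMatrix I) =
      ncDet (1 - sylvesterMatrix (variableMatrix I)) := by
  let a : Matrix (Fin n) (Fin n) (NCPowerSeries (Fin (n + p) × Fin (n + p)) ℂ) :=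
    Matrix.of fun i j => NCPowerSeries.X (Fin.castAdd p i, Fin.castAdd p j)
  have ha (i j) : NCPowerSeries.constantCoeff (a i j) = 0 := NCPowerSeries.constantCoeff_X _
  have hmap : I.ringCon.mk'.mapMatrix (1 - a) = 1 - leadingBlock (variableMatrix I) := by
    rw [map_sub, map_one]; rfl
  have hdet : IsUnit (ncDet (1 - leadingBlock (variableMatrix I))) := by
    rw [← hmap, RingHom.mapMatrix_apply, ← map_ncDet]
    refine (NCPowerSeries.isUnit_of_constantCoeff_eq_one ?_).map I.ringCon.mk'
    have h1 : (1 - a).map NCPowerSeries.constantCoeff = 1 := by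
      rw [← RingHom.mapMatrix_apply, map_sub, map_one, sub_eq_self]
      ext i j; exact ha i j
    rw [map_ncDet, h1, ncDet_eq_det, Matrix.det_one]
  obtain ⟨Y, hY⟩ := NCPowerSeries.exists_one_sub_mul_eq_one ha
  refine ⟨hdet, sylvester_identity hA hdet (Y := I.ringCon.mk'.mapMatrix Y) ?_⟩
  rw [← hmap, ← map_mul, hY, map_one]
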